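/- Let $1<p<\infty$ and let $\ell_p=\ell_p(\mathbb{N})$ be the real Banach space of $p$-summable real sequences. Write $\mathbb{L}(\ell_p)$ for the space of bounded linear operators on $\ell_p$ with the operator norm, and $\mathbb{K}(\ell_p)$ for its subspace of compact operators. For a unit vector $v$ of a real Banach space $\mathbb{X}$ put $J(v)=\{f\in\mathbb{X}^*:\|f\|=1,\ f(v)=1\}$, and let $\operatorname{Ext} J(v)$ be the set of extreme points of the convex set $J(v)$; $v$ is called $k$-smooth if $\dim\operatorname{span}J(v)=\dim\operatorname{span}\operatorname{Ext}J(v)=k$. Let $T\in\mathbb{L}(\ell_p)$ satisfy $\|T\|=1$ and $\operatorname{dist}(T,\mathbb{K}(\ell_p))<1$, where the distance is taken in the operator norm, and let $M_T=\{x\in\ell_p:\|x\|=1,\ \|Tx\|=\|T\|\}$ be its norm attainment set. If $M_T=\{\pm x_1,\pm x_2,\dots,\pm x_k\}$ with $x_1,\dots,x_k$ linearly independent in $\ell_p$, then $T$ is $k$-smooth as a unit vector of the Banach space $\mathbb{L}(\ell_p)$. -/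

import Mathlib

open scoped ENNReal

/-- The set `J(x)` of supporting linear functionals of `x` in a real normed space: the norm-one
continuous linear functionals `f` with `f x = 1`. -/
def supportingFunctionals {E : Type*} [NormedAddCommGroup E] [NormedSpace ℝ E] (x : E) :
    Set (StrongDual ℝ E) :=
  {f | ‖f‖ = 1 ∧ f x = 1}

/-- A unit vector `x` is `k`-smooth if `k = dim span J(x) = dim span Ext J(x)`. The dimensions are
cardinals, so that an infinite-dimensional span has no finite order of smoothness. -/
def IsKSmooth {E : Type*} [NormedAddCommGroup E] [NormedSpace ℝ E] (k : ℕ) (x : E) : Prop :=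
  ‖x‖ = 1 ∧
    Module.rank ℝ (Submodule.span ℝ (supportingFunctionals x)) = k ∧
    Module.rank ℝ (Submodule.span ℝ ((supportingFunctionals x).extremePoints ℝ)) = k

/-- The norm attainment set `M_T` of a bounded linear operator `T`. -/
def normAttainmentSet {E F : Type*} [NormedAddCommGroup E] [NormedSpace ℝ E]
    [NormedAddCommGroup F] [NormedSpace ℝ F] (T : E →L[ℝ] F) : Set E :=
  {x | ‖x‖ = 1 ∧ ‖T x‖ = ‖T‖}

/-- The set of compact operators among the bounded linear operators. -/
def compactOperators (E F : Type*) [NormedAddCommGroup E] [NormedSpace ℝ E]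
    [NormedAddCommGroup F] [NormedSpace ℝ F] : Set (E →L[ℝ] F) :=
  {S | IsCompactOperator S}

/-- The real sequence space `ℓ_p`. -/
abbrev RealLp (p : ℝ≥0∞) : Type := lp (fun _ : ℕ => ℝ) p

open Filter Topology

section Lp

theorem toReal_pos_of_fact {p : ℝ≥0∞} [Fact (1 ≤ p)] (hp : p < ∞) : 0 < p.toReal :=
  ENNReal.toReal_pos (zero_lt_one.trans_le Fact.out).ne' hp.ne

theorem one_lt_toReal {p : ℝ≥0∞} (hp₁ : 1 < p) (hp : p < ∞) : 1 < p.toReal := by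
  simpa using (ENNReal.toReal_lt_toReal ENNReal.one_ne_top hp.ne).2 hp₁

/-- The truncation of a sequence to a finite set of coordinates. -/
noncomputable def lpTruncate {p : ℝ≥0∞} (s : Finset ℕ) (u : RealLp p) : RealLp p :=
  ∑ i ∈ s, lp.single p i (u i)

theorem lpTruncate_apply {p : ℝ≥0∞} (s : Finset ℕ) (u : RealLp p) (i : ℕ) :
    lpTruncate s u i = if i ∈ s then u i else 0 := by
  simp only [lpTruncate, lp.coeFn_sum, Finset.sum_apply, lp.coeFn_single, Finset.sum_pi_single]

variable {p : ℝ≥0∞} [Fact (1 ≤ p)]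

theorem tendsto_lpTruncate (hp : p < ∞) (u : RealLp p) :
    Tendsto (fun s => lpTruncate s u) atTop (𝓝 u) := by
  simpa [HasSum, lpTruncate] using lp.hasSum_single hp.ne u

theorem tendsto_lpTruncate_zero {ι : Type*} {l : Filter ι} {h : ι → RealLp p}
    (hc : ∀ j, Tendsto (fun n => h n j) l (𝓝 0)) (s : Finset ℕ) :
    Tendsto (fun n => lpTruncate s (h n)) l (𝓝 0) := by
  have : Tendsto (fun n => ∑ i ∈ s, lp.single (E := fun _ : ℕ => ℝ) p i (h n i)) l
      (𝓝 (∑ i ∈ s, lp.single (E := fun _ : ℕ => ℝ) p i 0)) :=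
    tendsto_finsetSum s fun i _ =>
      ((lp.isometry_single (E := fun _ : ℕ => ℝ) (p := p) i).continuous.tendsto 0).comp (hc i)
  simpa [lpTruncate] using this

theorem norm_add_rpow_of_disjoint (hp : p < ∞) {a b : RealLp p} (hab : ∀ i, a i = 0 ∨ b i = 0) :
    ‖a + b‖ ^ p.toReal = ‖a‖ ^ p.toReal + ‖b‖ ^ p.toReal := by
  have hr := toReal_pos_of_fact hp
  refine (lp.hasSum_norm hr (a + b)).unique ?_
  convert (lp.hasSum_norm hr a).add (lp.hasSum_norm hr b) using 2 with i
  rcases hab i with h | h <;> simp [h, Real.zero_rpow hr.ne']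

theorem norm_add_of_disjoint (hp : p < ∞) {a b : RealLp p} (hab : ∀ i, a i = 0 ∨ b i = 0) :
    ‖a + b‖ = (‖a‖ ^ p.toReal + ‖b‖ ^ p.toReal) ^ p.toReal⁻¹ := by
  rw [← norm_add_rpow_of_disjoint hp hab,
    Real.rpow_rpow_inv (norm_nonneg _) (toReal_pos_of_fact hp).ne']

theorem tendsto_norm_add_of_finite_support (hp : p < ∞) {ι : Type*} {l : Filter ι}
    {h : ι → RealLp p} (hc : ∀ j, Tendsto (fun n => h n j) l (𝓝 0)) {L : ℝ}
    (hL : Tendsto (fun n => ‖h n‖) l (𝓝 L)) (u : RealLp p) (s : Finset ℕ) :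
    Tendsto (fun n => ‖lpTruncate s u + h n‖) l
      (𝓝 ((‖lpTruncate s u‖ ^ p.toReal + L ^ p.toReal) ^ p.toReal⁻¹)) := by
  have hr := toReal_pos_of_fact hp
  have h0 := tendsto_lpTruncate_zero hc s
  have h1 : Tendsto (fun n => ‖h n - lpTruncate s (h n)‖) l (𝓝 L) := by
    refine hL.congr_dist ?_
    refine squeeze_zero (fun _ => dist_nonneg) (fun n => ?_) (by simpa using h0.norm)
    simpa using dist_norm_norm_le (h n) (h n - lpTruncate s (h n))
  have h2 : Tendsto (fun n => ‖lpTruncate s u + (h n - lpTruncate s (h n))‖) l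
      (𝓝 ((‖lpTruncate s u‖ ^ p.toReal + L ^ p.toReal) ^ p.toReal⁻¹)) := by
    have : ∀ n, ‖lpTruncate s u + (h n - lpTruncate s (h n))‖ =
        (‖lpTruncate s u‖ ^ p.toReal + ‖h n - lpTruncate s (h n)‖ ^ p.toReal) ^ p.toReal⁻¹ := by
      intro n
      refine norm_add_of_disjoint hp fun i => ?_
      by_cases hi : i ∈ s <;> simp [lpTruncate_apply, hi]
    simp only [this]
    exact ((h1.rpow_const (Or.inr hr.le)).const_add _).rpow_const (Or.inr (inv_pos.2 hr).le)
  refine h2.congr_dist ?_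
  refine squeeze_zero (fun _ => dist_nonneg) (fun n => ?_) (by simpa using h0.norm)
  refine (dist_norm_norm_le _ _).trans (le_of_eq ?_)
  rw [← norm_neg]
  congr 1
  abel

/-- Asymptotic additivity of the `p`-th power of the norm along a coordinatewise null family. -/
theorem tendsto_norm_add_rpow (hp : p < ∞) {ι : Type*} {l : Filter ι}
    {h : ι → RealLp p} (hc : ∀ j, Tendsto (fun n => h n j) l (𝓝 0)) {L : ℝ} (hL₀ : 0 ≤ L)
    (hL : Tendsto (fun n => ‖h n‖) l (𝓝 L)) (u : RealLp p) :
    Tendsto (fun n => ‖u + h n‖ ^ p.toReal) l (𝓝 (‖u‖ ^ p.toReal + L ^ p.toReal)) := by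
  have hr := toReal_pos_of_fact hp
  have hu := tendsto_lpTruncate hp u
  have key : Tendsto (fun n => ‖u + h n‖) l
      (𝓝 ((‖u‖ ^ p.toReal + L ^ p.toReal) ^ p.toReal⁻¹)) := by
    refine TendstoUniformly.tendsto_of_eventually_tendsto
      (F := fun s n => ‖lpTruncate s u + h n‖) (p := atTop) ?_
      (Eventually.of_forall (tendsto_norm_add_of_finite_support hp hc hL u))
      (((hu.norm.rpow_const (Or.inr hr.le)).add_const _).rpow_const (Or.inr (inv_pos.2 hr).le))
    rw [Metric.tendstoUniformly_iff]
    intro ε hε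
    filter_upwards [Metric.tendsto_nhds.1 hu ε hε] with s hs n
    refine (dist_norm_norm_le _ _).trans_lt ?_
    rw [dist_comm, dist_eq_norm] at hs
    simpa using hs
  convert key.rpow_const (Or.inr hr.le) (p := p.toReal) using 2
  rw [Real.rpow_inv_rpow (by positivity) hr.ne']

theorem le_zero_of_tendsto_dual (hp₁ : 1 < p) (hp : p < ∞) {ι : Type*} {l : Filter ι} [l.NeBot]
    {h : ι → RealLp p} (hc : ∀ j, Tendsto (fun n => h n j) l (𝓝 0)) {L : ℝ}
    (hL : Tendsto (fun n => ‖h n‖) l (𝓝 L)) (φ : StrongDual ℝ (RealLp p)) {c : ℝ}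
    (hφ : Tendsto (fun n => φ (h n)) l (𝓝 c)) : c ≤ 0 := by
  have hr := one_lt_toReal hp₁ hp
  have hL₀ : 0 ≤ L := ge_of_tendsto' hL fun _ => norm_nonneg _
  set r := p.toReal with hrdef
  have bound : ∀ s : ℝ, 0 < s → c ≤ ‖φ‖ * (s ^ (r - 1) * L ^ r) := by
    intro s hs
    have hu : ∀ u : RealLp p, ‖u‖ ≤ 1 → φ u + s * c ≤ ‖φ‖ * (1 + s ^ r * L ^ r) := by
      intro u hu
      have h1 : Tendsto (fun n => ‖u + s • h n‖ ^ r) l (𝓝 (‖u‖ ^ r + (s * L) ^ r)) := by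
        refine tendsto_norm_add_rpow hp (fun j => ?_) (by positivity) ?_ u
        · simpa using (hc j).const_mul s
        · simpa [norm_smul, abs_of_pos hs] using hL.const_mul s
      have h2 : Tendsto (fun n => ‖u + s • h n‖) l (𝓝 ((‖u‖ ^ r + (s * L) ^ r) ^ r⁻¹)) := by
        refine (h1.rpow_const (Or.inr (by positivity)) (p := r⁻¹)).congr fun n => ?_
        rw [Real.rpow_rpow_inv (norm_nonneg _) (by positivity)]
      have h3 : φ u + s * c ≤ ‖φ‖ * (‖u‖ ^ r + (s * L) ^ r) ^ r⁻¹ := by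
        refine le_of_tendsto_of_tendsto' ((hφ.const_mul s).const_add (φ u)) (h2.const_mul ‖φ‖)
          fun n => ?_
        have := (le_abs_self _).trans (φ.le_opNorm (u + s • h n))
        simpa using this
      refine h3.trans (mul_le_mul_of_nonneg_left ?_ (norm_nonneg _))
      have h4 : ‖u‖ ^ r + (s * L) ^ r ≤ 1 + s ^ r * L ^ r := by
        rw [Real.mul_rpow hs.le hL₀]
        gcongr
        exact Real.rpow_le_one (norm_nonneg _) hu (by positivity)
      have h5 : (1 : ℝ) ≤ 1 + s ^ r * L ^ r := by
        have : 0 ≤ s ^ r * L ^ r := by positivity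
        linarith
      calc (‖u‖ ^ r + (s * L) ^ r) ^ r⁻¹ ≤ (1 + s ^ r * L ^ r) ^ r⁻¹ :=
            Real.rpow_le_rpow (by positivity) h4 (by positivity)
        _ ≤ (1 + s ^ r * L ^ r) ^ (1 : ℝ) :=
            Real.rpow_le_rpow_of_exponent_le h5 (inv_le_one_of_one_le₀ hr.le)
        _ = _ := Real.rpow_one _
    have hsup : ‖φ‖ + s * c ≤ ‖φ‖ * (1 + s ^ r * L ^ r) := by
      have : ‖φ‖ ≤ max 0 (‖φ‖ * (1 + s ^ r * L ^ r) - s * c) := by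
        refine ContinuousLinearMap.opNorm_le_of_unit_norm (le_max_left _ _) fun u hu1 => ?_
        refine le_max_of_le_right ?_
        rw [Real.norm_eq_abs, abs_le']
        constructor
        · linarith [hu u hu1.le]
        · have := hu (-u) (by simp [hu1])
          rw [map_neg] at this
          linarith
      rcases le_max_iff.1 this with h | h
      · have h0 := hu 0 (by simp)
        have : ‖φ‖ = 0 := le_antisymm h (norm_nonneg _)
        simp only [map_zero] at h0
        linarith
      · linarith
    have : s * c ≤ s * (‖φ‖ * (s ^ (r - 1) * L ^ r)) := by
      have e : s ^ r = s * s ^ (r - 1) := by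
        rw [Real.rpow_sub_one hs.ne']
        field_simp
      rw [e] at hsup
      linarith
    exact le_of_mul_le_mul_left this hs
  have lim : Tendsto (fun s : ℝ => ‖φ‖ * (s ^ (r - 1) * L ^ r)) (𝓝[>] 0) (𝓝 0) := by
    have h1 : Tendsto (fun s : ℝ => s ^ (r - 1)) (𝓝 0) (𝓝 (0 ^ (r - 1))) :=
      tendsto_id.rpow_const (Or.inr (by linarith))
    rw [Real.zero_rpow (by linarith)] at h1
    simpa using (((h1.mul_const (L ^ r)).const_mul ‖φ‖).mono_left nhdsWithin_le_nhds)
  exact ge_of_tendsto lim (eventually_mem_nhdsWithin.mono fun s hs => bound s hs)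

theorem Ultrafilter.exists_tendsto_of_bounded {ι : Type*} (U : Ultrafilter ι) {a : ι → ℝ} {C : ℝ}
    (ha : ∀ n, |a n| ≤ C) : ∃ c, Tendsto a U (𝓝 c) := by
  have hK : IsCompact (Set.Icc (-C) C) := isCompact_Icc
  obtain ⟨c, -, hc⟩ := hK.ultrafilter_le_nhds (U.map a)
    (le_principal_iff.2 (mem_map.2 (univ_mem' fun n => abs_le.1 (ha n))))
  exact ⟨c, hc⟩

/-- Bounded coordinatewise null families in `ℓ_p`, `1 < p < ∞`, are weakly null. -/
theorem tendsto_dual_zero (hp₁ : 1 < p) (hp : p < ∞) {ι : Type*} (U : Ultrafilter ι)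
    {h : ι → RealLp p} (hc : ∀ j, Tendsto (fun n => h n j) U (𝓝 0)) {C : ℝ}
    (hC : ∀ n, ‖h n‖ ≤ C) (φ : StrongDual ℝ (RealLp p)) :
    Tendsto (fun n => φ (h n)) U (𝓝 0) := by
  obtain ⟨L, hL⟩ := U.exists_tendsto_of_bounded (a := fun n => ‖h n‖) (C := C) (by simpa using hC)
  obtain ⟨c, hφ⟩ := U.exists_tendsto_of_bounded (a := fun n => φ (h n)) (C := ‖φ‖ * C) fun n =>
    (φ.le_opNorm _).trans (mul_le_mul_of_nonneg_left (hC n) (norm_nonneg _))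
  have h1 := le_zero_of_tendsto_dual hp₁ hp hc hL φ hφ
  have h2 := le_zero_of_tendsto_dual hp₁ hp hc hL (-φ) (c := -c) (by simpa using hφ.neg)
  rwa [le_antisymm h1 (by linarith)] at hφ

theorem exists_coordinatewise_limit {ι : Type*} (U : Ultrafilter ι)
    {u : ι → RealLp p} {C : ℝ} (hu : ∀ n, ‖u n‖ ≤ C) :
    ∃ v : RealLp p, ‖v‖ ≤ C ∧ ∀ j, Tendsto (fun n => u n j) U (𝓝 (v j)) := by
  have hp0 : p ≠ 0 := (zero_lt_one.trans_le (Fact.out : 1 ≤ p)).ne'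
  choose v hv using fun j => U.exists_tendsto_of_bounded (a := fun n => u n j) (C := C)
    fun n => (lp.norm_apply_le_norm hp0 (u n) j).trans (hu n)
  have hv' : Tendsto (id fun n => ⇑(u n) : ι → ∀ _ : ℕ, ℝ) U (𝓝 v) := tendsto_pi_nhds.2 hv
  have hmem : Memℓp v p := lp.memℓp_of_tendsto
    (isBounded_iff_forall_norm_le.2 ⟨C, Set.forall_mem_range.2 hu⟩) hv'
  exact ⟨⟨v, hmem⟩, lp.norm_le_of_tendsto (l := U) (Eventually.of_forall hu) hv', hv⟩

/-- Uniqueness of the supporting functional of a unit vector of `ℓ_p`, `1 < p < ∞`. -/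
theorem supportingFunctional_unique (hp₁ : 1 < p) (hp : p < ∞) {y : RealLp p} (hy : ‖y‖ = 1)
    {f g : StrongDual ℝ (RealLp p)} (hf : ‖f‖ ≤ 1) (hfy : f y = 1) (hg : ‖g‖ ≤ 1)
    (hgy : g y = 1) : f = g := by
  have hr := one_lt_toReal hp₁ hp
  have hr0 : 0 < p.toReal := by linarith
  have norm_line : ∀ (j : ℕ) (t : ℝ), ‖y + lp.single p j t‖ ^ p.toReal =
      1 - |y j| ^ p.toReal + |y j + t| ^ p.toReal := by
    intro j t
    have hd : ∀ s : ℝ, ‖(y - lp.single p j (y j)) + lp.single p j s‖ ^ p.toReal =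
        ‖y - lp.single p j (y j)‖ ^ p.toReal + |s| ^ p.toReal := by
      intro s
      rw [norm_add_rpow_of_disjoint hp, lp.norm_single (zero_lt_one.trans hp₁), Real.norm_eq_abs]
      intro i
      by_cases hi : i = j
      · subst hi; simp
      · right; exact lp.single_apply_ne (E := fun _ : ℕ => ℝ) p j s hi
    have h1 := hd (y j)
    rw [sub_add_cancel, hy, Real.one_rpow] at h1
    have h2 := hd (y j + t)
    rw [lp.single_add, ← add_assoc, sub_add_cancel] at h2
    linarith
  have coord : ∀ k : StrongDual ℝ (RealLp p), ‖k‖ ≤ 1 → k y = 1 → ∀ j : ℕ,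
      p.toReal * k (lp.single p j 1) =
        p.toReal * |y j| ^ (p.toReal - 2) * y j := by
    intro k hk hky j
    set a := k (lp.single p j 1) with ha
    let D : ℝ → ℝ := fun t => |y j + t| ^ p.toReal - p.toReal * (t * a)
    have hD : HasDerivAt D (p.toReal * |y j| ^ (p.toReal - 2) * y j - p.toReal * (1 * a)) 0 := by
      refine HasDerivAt.sub ?_ (((hasDerivAt_id _).mul_const a).const_mul _)
      have := hasDerivAt_abs_rpow (y j + 0) hr
      simpa using HasDerivAt.comp_const_add (y j) 0 this
    have hmin : IsLocalMin D 0 := by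
      have hnear : ∀ᶠ t : ℝ in 𝓝 0, -1 < t * a := by
        have : Tendsto (fun t : ℝ => t * a) (𝓝 0) (𝓝 (0 * a)) := tendsto_id.mul_const a
        exact this.eventually (lt_mem_nhds (by simp))
      filter_upwards [hnear] with t ht
      have h1 : 1 + t * a ≤ ‖y + lp.single p j t‖ := by
        have e : k (y + lp.single p j t) = 1 + t * a := by
          have : lp.single (E := fun _ : ℕ => ℝ) p j t = t • lp.single p j 1 := by
            rw [← lp.single_smul]; simp
          rw [map_add, hky, this, map_smul, smul_eq_mul]
        rw [← e]
        exact (le_abs_self _).trans ((k.le_of_opNorm_le hk _).trans_eq (one_mul _))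
      have h2 : 1 + p.toReal * (t * a) ≤ ‖y + lp.single p j t‖ ^ p.toReal :=
        (one_add_mul_self_le_rpow_one_add ht.le hr.le).trans
          (Real.rpow_le_rpow (by linarith) h1 hr0.le)
      rw [norm_line] at h2
      simp only [D, add_zero, zero_mul, mul_zero, sub_zero]
      linarith
    have := hmin.hasDerivAt_eq_zero hD
    linarith
  refine lp.ext_continuousLinearMap hp.ne fun j => ?_
  ext
  have := (coord f hf hfy j).trans (coord g hg hgy j).symm
  simpa [hr0.ne'] using this

end Lp

section KSmooth

/-- Linearly independent vectors of a normed space admit a dual family of continuous functionals. -/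
theorem exists_dual_family {E : Type*} [NormedAddCommGroup E] [NormedSpace ℝ E] {k : ℕ}
    {x : Fin k → E} (hx : LinearIndependent ℝ x) :
    ∃ φ : Fin k → StrongDual ℝ E, ∀ i j, φ j (x i) = if i = j then 1 else 0 := by
  have hinj : Function.Injective (Fintype.linearCombination ℝ x) :=
    hx.fintypeLinearCombination_injective
  have hsurj := SeparatingDual.dualMap_surjective_iff.2 hinj
  choose φ hφ using fun j => hsurj (LinearMap.proj j)
  refine ⟨φ, fun i j => ?_⟩
  have := LinearMap.congr_fun (hφ j) (Pi.single i 1)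
  simp [Fintype.linearCombination_apply_single] at this
  rw [this, Pi.single_apply]
  simp [eq_comm]

/-- A criterion for `k`-smoothness: a biorthogonal family of supporting functionals that determines
the supporting functionals by duality. -/
theorem isKSmooth_of_biorthogonal {E : Type*} [NormedAddCommGroup E] [NormedSpace ℝ E] {k : ℕ}
    {v : E} (hv : ‖v‖ = 1) {f : Fin k → StrongDual ℝ E} {S : Fin k → E}
    (hfS : ∀ i j, f i (S j) = if i = j then 1 else 0)
    (hf : ∀ i, f i ∈ supportingFunctionals v)
    (hcone : ∀ g ∈ supportingFunctionals v, ∀ V : E, (∀ i, f i V ≤ 0) → g V ≤ 0) :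
    IsKSmooth k v := by
  have hexp : ∀ g ∈ supportingFunctionals v, g = ∑ j, g (S j) • f j := by
    intro g hg
    ext V
    have hz : ∀ i, f i (V - ∑ j, f j V • S j) = 0 := by
      intro i
      simp [map_sub, map_sum, hfS]
    have h1 := hcone g hg _ fun i => (hz i).le
    have h2 := hcone g hg (-(V - ∑ j, f j V • S j)) fun i => by rw [map_neg, hz i, neg_zero]
    rw [map_neg] at h2
    have h3 : g (V - ∑ j, f j V • S j) = 0 := le_antisymm h1 (by linarith)
    rw [map_sub, sub_eq_zero] at h3
    rw [h3]
    simp [map_sum, mul_comm]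
  have hnonneg : ∀ g ∈ supportingFunctionals v, ∀ j, 0 ≤ g (S j) := by
    intro g hg j
    have := hcone g hg (-S j) fun i => by
      rw [map_neg, hfS]
      split_ifs <;> simp
    rw [map_neg] at this
    linarith
  have hli : LinearIndependent ℝ f := by
    rw [Fintype.linearIndependent_iff]
    intro c hc j
    have := DFunLike.congr_fun hc (S j)
    simpa [hfS] using this
  have hext : ∀ i, f i ∈ (supportingFunctionals v).extremePoints ℝ := by
    intro i
    refine ⟨hf i, ?_⟩
    rintro g hg g' hg' ⟨a, b, ha, hb, hab, hcomb⟩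
    have hzero : ∀ j, j ≠ i → g (S j) = 0 := by
      intro j hj
      have h := DFunLike.congr_fun hcomb (S j)
      simp only [add_apply, smul_apply, smul_eq_mul, hfS, if_neg hj.symm] at h
      have h1 := mul_nonneg ha.le (hnonneg g hg j)
      have h2 := mul_nonneg hb.le (hnonneg g' hg' j)
      have h3 : a * g (S j) = 0 := by linarith
      exact (mul_eq_zero.1 h3).resolve_left ha.ne'
    have hgi : g = g (S i) • f i := by
      conv_lhs => rw [hexp g hg]
      exact Finset.sum_eq_single i (fun j _ hj => by rw [hzero j hj, zero_smul]) (by simp)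
    have h1 : g (S i) = 1 := by
      have := DFunLike.congr_fun hgi v
      simpa [hg.2, (hf i).2] using this.symm
    rw [hgi, h1, one_smul]
  have hrange : Module.rank ℝ (Submodule.span ℝ (Set.range f)) = k := by
    have := FiniteDimensional.span_of_finite ℝ (Set.finite_range f)
    rw [← Module.finrank_eq_rank, finrank_span_eq_card hli, Fintype.card_fin]
  have hJ : supportingFunctionals v ⊆ Submodule.span ℝ (Set.range f) := by
    intro g hg
    rw [hexp g hg]
    exact Submodule.sum_mem _ fun j _ =>
      Submodule.smul_mem _ _ (Submodule.subset_span (Set.mem_range_self j))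
  have e1 : Submodule.span ℝ (supportingFunctionals v) = Submodule.span ℝ (Set.range f) :=
    le_antisymm (Submodule.span_le.2 hJ)
      (Submodule.span_mono (Set.range_subset_iff.2 hf))
  have e2 : Submodule.span ℝ ((supportingFunctionals v).extremePoints ℝ) =
      Submodule.span ℝ (Set.range f) :=
    le_antisymm (Submodule.span_le.2 (extremePoints_subset.trans hJ))
      (Submodule.span_mono (Set.range_subset_iff.2 hext))
  exact ⟨hv, by rw [e1, hrange], by rw [e2, hrange]⟩

end KSmooth

section NormAttainment

variable {p : ℝ≥0∞} [Fact (1 ≤ p)]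

/-- Compact operators map bounded coordinatewise null families in `ℓ_p` to norm null families. -/
theorem tendsto_compactOperator_zero (hp₁ : 1 < p) (hp : p < ∞) {ι : Type*} (U : Ultrafilter ι)
    {h : ι → RealLp p} (hc : ∀ j, Tendsto (fun n => h n j) U (𝓝 0)) {C : ℝ}
    (hC : ∀ n, ‖h n‖ ≤ C) {K : RealLp p →L[ℝ] RealLp p} (hK : IsCompactOperator K) :
    Tendsto (fun n => K (h n)) U (𝓝 0) := by
  obtain ⟨A, hA, hKA⟩ := hK.image_closedBall_subset_compact (f := (K : RealLp p →ₗ[ℝ] RealLp p)) C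
  have hmem : ∀ n, K (h n) ∈ A := fun n => hKA ⟨h n, by simpa using hC n, rfl⟩
  obtain ⟨w, -, hw⟩ := hA.ultrafilter_le_nhds (U.map fun n => K (h n))
    (le_principal_iff.2 (mem_map.2 (univ_mem' hmem)))
  have hw' : Tendsto (fun n => K (h n)) U (𝓝 w) := hw
  have hzero : w = 0 := by
    ext j
    let e : StrongDual ℝ (RealLp p) := lp.evalCLM ℝ (fun _ : ℕ => ℝ) p j
    have h1 : Tendsto (fun n => e (K (h n))) U (𝓝 (e w)) := (e.continuous.tendsto w).comp hw'
    have h2 := tendsto_dual_zero hp₁ hp U hc hC (e.comp K)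
    exact tendsto_nhds_unique h1 h2
  rwa [hzero] at hw'

/-- An almost norming family of a norm-one operator at distance less than one from the compact
operators converges in norm to a point of norm attainment. -/
theorem exists_tendsto_normAttainmentSet (hp₁ : 1 < p) (hp : p < ∞)
    {T : RealLp p →L[ℝ] RealLp p} (hT : ‖T‖ = 1)
    (hdist : Metric.infDist T (compactOperators (RealLp p) (RealLp p)) < 1)
    {ι : Type*} (U : Ultrafilter ι) {u : ι → RealLp p} (hu : ∀ n, ‖u n‖ ≤ 1)
    (hTu : Tendsto (fun n => ‖T (u n)‖) U (𝓝 1)) :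
    ∃ v ∈ normAttainmentSet T, Tendsto u U (𝓝 v) := by
  have hr := one_lt_toReal hp₁ hp
  have hr0 : 0 < p.toReal := by linarith
  have hTle : ∀ w, ‖T w‖ ≤ ‖w‖ := fun w => by simpa [hT] using T.le_opNorm w
  obtain ⟨K, hK, hTK⟩ := (Metric.infDist_lt_iff
    ⟨(0 : RealLp p →L[ℝ] RealLp p), isCompactOperator_zero⟩).1 hdist
  rw [dist_eq_norm] at hTK
  obtain ⟨v, hv, huv⟩ := exists_coordinatewise_limit U hu
  set h : ι → RealLp p := fun n => u n - v with hdef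
  have hc : ∀ j, Tendsto (fun n => h n j) U (𝓝 0) := fun j => by
    simpa [h] using (huv j).sub_const (v j)
  have hC : ∀ n, ‖h n‖ ≤ 2 := fun n => (norm_sub_le _ _).trans (by linarith [hu n])
  have hTC : ∀ n, ‖T (h n)‖ ≤ 2 := fun n => (hTle _).trans (hC n)
  obtain ⟨L, hL⟩ := U.exists_tendsto_of_bounded (a := fun n => ‖h n‖) (C := 2) (by simpa using hC)
  obtain ⟨M, hM⟩ := U.exists_tendsto_of_bounded (a := fun n => ‖T (h n)‖) (C := 2)
    (by simpa using hTC)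
  have hL₀ : 0 ≤ L := ge_of_tendsto' hL fun _ => norm_nonneg _
  have hM₀ : 0 ≤ M := ge_of_tendsto' hM fun _ => norm_nonneg _
  have hTc : ∀ j, Tendsto (fun n => T (h n) j) U (𝓝 0) := fun j =>
    tendsto_dual_zero hp₁ hp U hc hC
      ((lp.evalCLM ℝ (fun _ : ℕ => ℝ) p j : StrongDual ℝ (RealLp p)).comp T)
  have hML : M ≤ ‖T - K‖ * L := by
    have h1 : Tendsto (fun n => ‖T - K‖ * ‖h n‖ + ‖K (h n)‖) U (𝓝 (‖T - K‖ * L + 0)) :=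
      (hL.const_mul _).add (by simpa using (tendsto_compactOperator_zero hp₁ hp U hc hC hK).norm)
    rw [add_zero] at h1
    refine le_of_tendsto_of_tendsto' hM h1 fun n => ?_
    have h2 : T (h n) = (T - K) (h n) + K (h n) := by simp
    rw [h2]
    exact (norm_add_le _ _).trans (add_le_add_left ((T - K).le_opNorm _) _)
  have hu_lim : ‖v‖ ^ p.toReal + L ^ p.toReal ≤ 1 := by
    refine le_of_tendsto' (tendsto_norm_add_rpow hp hc hL₀ hL v) fun n => ?_
    simpa [h] using Real.rpow_le_one (norm_nonneg _) (hu n) hr0.le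
  have hTu_lim : ‖T v‖ ^ p.toReal + M ^ p.toReal = 1 := by
    have h1 := tendsto_norm_add_rpow hp hTc hM₀ hM (T v)
    have h2 := hTu.rpow_const (p := p.toReal) (Or.inr hr0.le)
    rw [Real.one_rpow] at h2
    refine tendsto_nhds_unique h1 (h2.congr fun n => ?_)
    simp [h]
  have hTv : ‖T v‖ ^ p.toReal ≤ ‖v‖ ^ p.toReal :=
    Real.rpow_le_rpow (norm_nonneg _) (hTle v) hr0.le
  have hLM : L ^ p.toReal ≤ M ^ p.toReal := by linarith
  have hLM' : L ≤ M := (Real.rpow_le_rpow_iff hL₀ hM₀ hr0).1 hLM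
  have hLzero : L = 0 := by
    by_contra hne
    have hLpos : 0 < L := lt_of_le_of_ne hL₀ (Ne.symm hne)
    nlinarith
  have hMzero : M = 0 := by
    rw [hLzero, mul_zero] at hML
    exact le_antisymm hML hM₀
  have hTv1 : ‖T v‖ = 1 := by
    rw [hMzero, Real.zero_rpow hr0.ne', add_zero] at hTu_lim
    exact (Real.rpow_left_inj (norm_nonneg _) zero_le_one hr0.ne').1
      (hTu_lim.trans (Real.one_rpow _).symm)
  refine ⟨v, ⟨le_antisymm hv (hTv1 ▸ hTle v), hTv1.trans hT.symm⟩, ?_⟩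
  rw [hLzero] at hL
  exact tendsto_iff_norm_sub_tendsto_zero.2 hL

/-- A direction that strictly decreases at every norming pair does not increase the norm. -/
theorem exists_norm_add_smul_le_one (hp₁ : 1 < p) (hp : p < ∞)
    {T : RealLp p →L[ℝ] RealLp p} (hT : ‖T‖ = 1)
    (hdist : Metric.infDist T (compactOperators (RealLp p) (RealLp p)) < 1)
    {S : RealLp p →L[ℝ] RealLp p}
    (hS : ∀ v ∈ normAttainmentSet T, ∀ g : StrongDual ℝ (RealLp p), ‖g‖ ≤ 1 → g (T v) = 1 →
      g (S v) < 0) :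
    ∃ t : ℝ, 0 < t ∧ ‖T + t • S‖ ≤ 1 := by
  by_contra! hcon
  let t : ℕ → ℝ := fun n => 1 / ((n : ℝ) + 1)
  have htpos : ∀ n, 0 < t n := fun n => Nat.one_div_pos_of_nat
  let U : Ultrafilter ℕ := hyperfilter ℕ
  have hUle : (U : Filter ℕ) ≤ atTop := by
    rw [← Nat.cofinite_eq_atTop]
    exact hyperfilter_le_cofinite
  have ht : Tendsto t U (𝓝 0) := tendsto_one_div_add_atTop_nhds_zero_nat.mono_left hUle
  choose u hu1 hu using fun n => (T + t n • S).exists_lt_apply_of_lt_opNorm (hcon (t n) (htpos n))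
  have hTle : ∀ w, ‖T w‖ ≤ ‖w‖ := fun w => by simpa [hT] using T.le_opNorm w
  have hSu : ∀ n, ‖t n • S (u n)‖ ≤ t n * ‖S‖ := fun n => by
    rw [norm_smul, Real.norm_of_nonneg (htpos n).le]
    exact mul_le_mul_of_nonneg_left ((S.le_opNorm _).trans
      (mul_le_of_le_one_right (norm_nonneg _) (hu1 n).le)) (htpos n).le
  have hTu : Tendsto (fun n => ‖T (u n)‖) U (𝓝 1) := by
    have hlow : Tendsto (fun n => 1 - t n * ‖S‖) U (𝓝 1) := by
      simpa using (ht.mul_const ‖S‖).const_sub 1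
    refine tendsto_of_tendsto_of_tendsto_of_le_of_le hlow tendsto_const_nhds (fun n => ?_)
      (fun n => (hTle _).trans (hu1 n).le)
    have h1 : 1 < ‖T (u n) + t n • S (u n)‖ := hu n
    have h2 := norm_add_le (T (u n)) (t n • S (u n))
    have h3 := hSu n
    show 1 - t n * ‖S‖ ≤ ‖T (u n)‖
    linarith
  obtain ⟨v, hv, huv⟩ := exists_tendsto_normAttainmentSet hp₁ hp hT hdist U
    (fun n => (hu1 n).le) hTu
  choose g hg hgu using fun n => exists_dual_vector'' ℝ ((T + t n • S) (u n))
  obtain ⟨g₀, hg₀, hlim⟩ :=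
    (WeakDual.isCompact_closedBall (𝕜 := ℝ) (0 : StrongDual ℝ (RealLp p)) 1).ultrafilter_le_nhds
      (U.map fun n => StrongDual.toWeakDual (g n))
      (le_principal_iff.2 (mem_map.2 (univ_mem' fun n => by simpa using hg n)))
  have hglim : ∀ w, Tendsto (fun n => g n w) U (𝓝 (g₀ w)) := fun w =>
    ((WeakDual.eval_continuous w).tendsto g₀).comp hlim
  have hglim' : ∀ {w : ℕ → RealLp p} {w₀ : RealLp p}, Tendsto w U (𝓝 w₀) →
      Tendsto (fun n => g n (w n)) U (𝓝 (g₀ w₀)) := by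
    intro w w₀ hw
    refine (hglim w₀).congr_dist ?_
    refine squeeze_zero (fun _ => dist_nonneg) (fun n => ?_)
      (tendsto_iff_norm_sub_tendsto_zero.1 hw)
    rw [dist_comm, dist_eq_norm, ← map_sub]
    exact ((g n).le_of_opNorm_le (hg n) _).trans_eq (one_mul _)
  have hTuv : Tendsto (fun n => T (u n)) U (𝓝 (T v)) := (T.continuous.tendsto v).comp huv
  have hSuv : Tendsto (fun n => S (u n)) U (𝓝 (S v)) := (S.continuous.tendsto v).comp huv
  have hgTu : ∀ n, g n (T (u n)) ≤ 1 := fun n => by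
    have h1 := (le_abs_self _).trans ((g n).le_of_opNorm_le (hg n) (T (u n)))
    linarith [hTle (u n), hu1 n]
  have hsum : ∀ n, 1 < g n (T (u n)) + t n * g n (S (u n)) := fun n => by
    have h1 := hu n
    have h2 := hgu n
    simp only [add_apply, smul_apply, map_add, map_smul, smul_eq_mul] at h1 h2
    simp only [RCLike.ofReal_real_eq_id, id_eq] at h2
    rw [h2]
    exact h1
  have hgS : 0 ≤ g₀ (S v) := by
    refine ge_of_tendsto' (hglim' hSuv) fun n => ?_
    have : 0 < t n * g n (S (u n)) := by linarith [hsum n, hgTu n]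
    exact (pos_of_mul_pos_right this (htpos n).le).le
  have hgT : g₀ (T v) = 1 := by
    refine le_antisymm (le_of_tendsto' (hglim' hTuv) hgTu) ?_
    have h1 : Tendsto (fun n => g n (T (u n)) + t n * g n (S (u n))) U
        (𝓝 (g₀ (T v) + 0 * g₀ (S v))) := (hglim' hTuv).add (ht.mul (hglim' hSuv))
    rw [zero_mul, add_zero] at h1
    exact ge_of_tendsto' h1 fun n => (hsum n).le
  have hg₀' : ‖WeakDual.toStrongDual g₀‖ ≤ 1 := by simpa using hg₀
  exact absurd (hS v hv (WeakDual.toStrongDual g₀) hg₀' hgT) (not_lt.2 hgS)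

end NormAttainment

theorem mainTheorem10 (p : ℝ≥0∞) [Fact (1 ≤ p)] (hp₁ : 1 < p) (hp₂ : p < ∞)
    (T : RealLp p →L[ℝ] RealLp p) (hT : ‖T‖ = 1)
    (hdist : Metric.infDist T (compactOperators (RealLp p) (RealLp p)) < 1)
    (k : ℕ) (x : Fin k → RealLp p) (hx : LinearIndependent ℝ x)
    (hM : normAttainmentSet T = Set.range x ∪ Set.range (fun i => -x i)) :
    IsKSmooth k T := by
  have hxM : ∀ i, x i ∈ normAttainmentSet T := fun i => hM ▸ Or.inl (Set.mem_range_self i)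
  have hTx : ∀ i, ‖T (x i)‖ = 1 := fun i => (hxM i).2.trans hT
  obtain ⟨φ, hφ⟩ := exists_dual_family hx
  choose y hy hyT using fun i =>
    exists_dual_vector ℝ (T (x i)) (by rw [hTx i]; exact one_ne_zero)
  have hyT' : ∀ i, y i (T (x i)) = 1 := fun i => by simpa [hTx i] using hyT i
  let f : Fin k → StrongDual ℝ (RealLp p →L[ℝ] RealLp p) := fun i =>
    (y i).comp (ContinuousLinearMap.apply ℝ (RealLp p) (x i))
  have hfapp : ∀ i (S : RealLp p →L[ℝ] RealLp p), f i S = y i (S (x i)) := fun _ _ => rfl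
  have hfle : ∀ i, ‖f i‖ ≤ 1 := fun i =>
    (f i).opNorm_le_bound zero_le_one fun S => by
      rw [hfapp, one_mul]
      have h1 := (y i).le_opNorm (S (x i))
      have h2 := S.le_opNorm (x i)
      rw [hy i, one_mul] at h1
      rw [(hxM i).1, mul_one] at h2
      exact h1.trans h2
  have hfT : ∀ i, f i T = 1 := hyT'
  have hfJ : ∀ i, f i ∈ supportingFunctionals T := fun i => by
    refine ⟨le_antisymm (hfle i) ?_, hfT i⟩
    have := (f i).le_opNorm T
    rwa [hfT i, hT, mul_one, norm_one] at this
  refine isKSmooth_of_biorthogonal hT (f := f) (S := fun j => (φ j).smulRight (T (x j))) ?_ hfJ ?_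
  · intro i j
    rw [hfapp]
    by_cases hij : i = j
    · subst hij; simp [hφ, hyT']
    · simp [hφ, hij]
  · have hstrict : ∀ g ∈ supportingFunctionals T, ∀ V : RealLp p →L[ℝ] RealLp p,
        (∀ i, f i V < 0) → g V ≤ 0 := by
      intro g hg V hV
      obtain ⟨t, ht, htV⟩ := exists_norm_add_smul_le_one hp₁ hp₂ hT hdist (S := V) (by
        intro v hv k hk hkv
        rw [hM] at hv
        rcases hv with ⟨i, rfl⟩ | ⟨i, rfl⟩
        · rw [supportingFunctional_unique hp₁ hp₂ (hTx i) hk hkv (hy i).le (hyT' i)]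
          exact hV i
        · have hk' : (-k) (T (x i)) = 1 := by simpa using hkv
          have := supportingFunctional_unique hp₁ hp₂ (hTx i) (f := -k) (by simpa using hk) hk'
            (hy i).le (hyT' i)
          have h2 := hV i
          rw [hfapp, ← this] at h2
          simpa using h2)
      have h1 := (le_abs_self _).trans (g.le_opNorm (T + t • V))
      rw [hg.1, one_mul, map_add, map_smul, hg.2, smul_eq_mul] at h1
      have h2 : t * g V ≤ 0 := by linarith
      exact nonpos_of_mul_nonpos_right h2 ht
    intro g hg V hV
    refine le_of_forall_pos_le_add fun ε hε => ?_
    have := hstrict g hg (V - ε • T) fun i => by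
      rw [map_sub, map_smul, hfT, smul_eq_mul, mul_one]
      linarith [hV i]
    rw [map_sub, map_smul, hg.2, smul_eq_mul, mul_one] at this
    linarith
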